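/- Let $\mathcal{P}_2=\{(x,x^2): x\in\mathbb{R}\}\subset\mathbb{R}^2$ be the standard parabola and, for $E\subset\mathbb{R}^2$, let $\Pi(E)=\{u\cdot v: u,v\in E\}\subset\mathbb{R}$ be its dot product set. Write $\dim_H$ for Hausdorff dimension and $|\cdot|$ for Lebesgue measure on $\mathbb{R}$. For all $x,y\in\mathbb{R}$ one has $(x,x^2)\cdot(y,y^2)=\left(xy+\tfrac12\right)^2-\tfrac14$. Moreover, there exists a compact set $F\subset\mathbb{R}$ with $\dim_H F=1$ and $|\{xy: x,y\in F\}|=0$ such that the set $E=\{(x,x^2): x\in F\}$ is a compact subset of $\mathcal{P}_2$ with $\dim_H E=1$ and $|\Pi(E)|=0$. In particular, there exists a compact subset $E$ of $\mathcal{P}_2$ with $\dim_H E=1$ and $|\Pi(E)|=0$. -/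

import Mathlib

open MeasureTheory

/-- The point `(x, x²)` of the Euclidean plane. -/
noncomputable def parabolaPoint (x : ℝ) : EuclideanSpace ℝ (Fin 2) :=
  !₂[x, x ^ 2]

/-- The standard parabola `{(x, x²) : x ∈ ℝ}` in the Euclidean plane. -/
def standardParabola : Set (EuclideanSpace ℝ (Fin 2)) :=
  Set.range parabolaPoint

/-- The dot product set `{x · y : x, y ∈ E}` of a set `E` in Euclidean `d`-space. -/
def dotProductSet {d : ℕ} (E : Set (EuclideanSpace ℝ (Fin d))) : Set ℝ :=
  {t : ℝ | ∃ x ∈ E, ∃ y ∈ E, t = inner ℝ x y}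

/-! By the identity in `inner_parabolaPoint`, the dot product set is a polynomial image of the
product set of `F`, and passing to the parabola keeps the dimension. Exponentiating reduces the
problem to a compact `G` in `[0, ∞)` of dimension 1 with null sumset. `G` is `{0}` together with
Cantor sets `K j`, whose digits in base `2 ^ 2 ^ (j + 2)` lie in the lowest quarter of the digit
range. Their dimensions tend to 1 (`le_dimH_range_sparseDigitsPoint`). For `i ≤ j` the base of `K j`
is a power of that of `K i`, so in the larger base all shifts of points of both sets have fractional
part at most `1/4`. Shifts of a sum then stay below `1/2`, which confines it to a null set
(`volume_shiftFractLE_half`). -/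

open Set Filter Topology
open scoped Pointwise

/-! ### Reals with restricted shifts -/

/-- The reals all of whose base `2 ^ L` shifts have fractional part at most `c`. -/
def shiftFractLE (L : ℕ) (c : ℝ) : Set ℝ :=
  {x | ∀ n : ℕ, Int.fract (2 ^ (L * n) * x) ≤ c}

lemma shiftFractLE_subset_of_dvd {L M : ℕ} (h : L ∣ M) (c : ℝ) :
    shiftFractLE L c ⊆ shiftFractLE M c := by
  obtain ⟨k, rfl⟩ := h
  intro x hx n
  rw [mul_assoc]
  exact hx (k * n)

lemma add_mem_shiftFractLE {L : ℕ} {c d x y : ℝ} (hx : x ∈ shiftFractLE L c)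
    (hy : y ∈ shiftFractLE L d) : x + y ∈ shiftFractLE L (c + d) := by
  intro n
  rw [mul_add]
  exact (Int.fract_add_le _ _).trans (add_le_add (hx n) (hy n))

lemma fract_mem_shiftFractLE {L : ℕ} {c x : ℝ} (hx : x ∈ shiftFractLE L c) :
    Int.fract x ∈ shiftFractLE L c := by
  intro n
  have h : (2 : ℝ) ^ (L * n) * Int.fract x =
      2 ^ (L * n) * x - ((2 ^ (L * n) * ⌊x⌋ : ℤ) : ℝ) := by
    rw [Int.fract]; push_cast; ring
  rw [h, Int.fract_sub_intCast]
  exact hx n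

lemma pow_mul_mem_shiftFractLE {L : ℕ} {c x : ℝ} (hx : x ∈ shiftFractLE L c) :
    2 ^ L * x ∈ shiftFractLE L c := by
  intro n
  have h : (2 : ℝ) ^ (L * n) * (2 ^ L * x) = 2 ^ (L * (n + 1)) * x := by ring
  rw [h]
  exact hx (n + 1)

/-- With `L = l + 1`, the first digit is at most `2 ^ l` (equality only at `x = 1/2`), so `T` is
covered by `2 ^ l + 1` copies of itself scaled by `2 ^ (-(l + 1))`. The total ratio is below 1
exactly when `l ≥ 1`, and `T` has finite measure. -/
lemma volume_shiftFractLE_half_inter_Ico {L : ℕ} (hL : 2 ≤ L) :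
    volume (shiftFractLE L (1 / 2) ∩ Ico 0 1) = 0 := by
  set T := shiftFractLE L (1 / 2) ∩ Ico (0 : ℝ) 1 with hT
  obtain ⟨l, rfl⟩ : ∃ l, L = l + 1 := ⟨L - 1, by omega⟩
  have hl : 1 ≤ l := by omega
  have hcover : T ⊆ ⋃ k ∈ Finset.range (2 ^ l + 1),
      (fun y : ℝ => ((2 : ℝ) ^ (l + 1))⁻¹ * (k + y)) '' T := by
    rintro x ⟨hx, hx0, hx1⟩
    have hhalf : x ≤ 1 / 2 := by
      have := hx 0
      simpa [Int.fract_eq_self.2 ⟨hx0, hx1⟩] using this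
    have hpos : (0 : ℝ) ≤ 2 ^ (l + 1) * x := by positivity
    simp only [mem_iUnion, Finset.mem_range]
    refine ⟨⌊(2 : ℝ) ^ (l + 1) * x⌋₊, ?_, Int.fract (2 ^ (l + 1) * x), ⟨?_, ?_, ?_⟩, ?_⟩
    · rw [Nat.lt_succ_iff]
      refine Nat.floor_le_of_le ?_
      push_cast
      rw [pow_succ]
      nlinarith [pow_pos (two_pos : (0 : ℝ) < 2) l]
    · exact fract_mem_shiftFractLE (pow_mul_mem_shiftFractLE hx)
    · exact Int.fract_nonneg _
    · exact Int.fract_lt_one _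
    · have : ((⌊(2 : ℝ) ^ (l + 1) * x⌋₊ : ℕ) : ℝ) = (⌊(2 : ℝ) ^ (l + 1) * x⌋ : ℝ) :=
        natCast_floor_eq_intCast_floor hpos
      simp only [this, Int.floor_add_fract]
      field_simp
  have himage (k : ℕ) : volume ((fun y : ℝ => ((2 : ℝ) ^ (l + 1))⁻¹ * (k + y)) '' T) =
      ENNReal.ofReal ((2 : ℝ) ^ (l + 1))⁻¹ * volume T := by
    have : (fun y : ℝ => ((2 : ℝ) ^ (l + 1))⁻¹ * (k + y)) '' T =
        ((2 : ℝ) ^ (l + 1))⁻¹ • ((fun y : ℝ => (k : ℝ) + y) '' T) := by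
      rw [← image_smul, image_image]
      rfl
    rw [this, Measure.addHaar_smul]
    simp [abs_of_nonneg]
  have hfin : volume T ≠ ⊤ :=
    ((measure_mono inter_subset_right).trans_lt (by simp [Real.volume_Ico])).ne
  have hle : volume T ≤
      ENNReal.ofReal ((2 ^ l + 1) * ((2 : ℝ) ^ (l + 1))⁻¹) * volume T := by
    calc volume T ≤ ∑ k ∈ Finset.range (2 ^ l + 1),
          volume ((fun y : ℝ => ((2 : ℝ) ^ (l + 1))⁻¹ * (k + y)) '' T) :=
        (measure_mono hcover).trans (measure_biUnion_finset_le _ _)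
      _ = _ := by
        simp_rw [himage]
        rw [Finset.sum_const, Finset.card_range, nsmul_eq_mul, ← mul_assoc,
          ENNReal.ofReal_mul (by positivity)]
        congr 2
        rw [← ENNReal.ofReal_natCast]
        push_cast
        rfl
  rw [← ENNReal.ofReal_toReal hfin, ← ENNReal.ofReal_mul (by positivity)] at hle
  have hle' := (ENNReal.ofReal_le_ofReal_iff (by positivity)).1 hle
  have hratio : (2 ^ l + 1) * ((2 : ℝ) ^ (l + 1))⁻¹ < 1 := by
    rw [← div_eq_mul_inv, div_lt_one (by positivity), pow_succ]
    have : (2 : ℝ) ^ 1 ≤ 2 ^ l := pow_le_pow_right₀ (by norm_num) hl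
    linarith
  have hnn : 0 ≤ (volume T).toReal := ENNReal.toReal_nonneg
  have hzero : (volume T).toReal = 0 := by nlinarith
  exact ((ENNReal.toReal_eq_zero_iff _).1 hzero).resolve_right hfin

lemma volume_shiftFractLE_half {L : ℕ} (hL : 2 ≤ L) :
    volume (shiftFractLE L (1 / 2)) = 0 := by
  have hcover : shiftFractLE L (1 / 2) ⊆
      ⋃ k : ℤ, (fun y : ℝ => (k : ℝ) + y) '' (shiftFractLE L (1 / 2) ∩ Ico 0 1) := by
    intro x hx
    exact mem_iUnion.2 ⟨⌊x⌋, Int.fract x, ⟨fract_mem_shiftFractLE hx, Int.fract_nonneg x,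
      Int.fract_lt_one x⟩, Int.floor_add_fract x⟩
  refine measure_mono_null hcover (measure_iUnion_null fun k => ?_)
  rw [image_add_left, measure_preimage_add]
  exact volume_shiftFractLE_half_inter_Ico hL

/-! ### Cantor sets with small digits -/

/-- The point with base `4 * D` digits `0, a 0, a 1, …`, where `a i < D`. -/
noncomputable def sparseDigitsPoint (D : ℕ) (a : ℕ → Fin D) : ℝ :=
  ((4 * D : ℕ) : ℝ)⁻¹ *
    Real.ofDigits (fun i => Fin.castLE (by omega : D ≤ 4 * D) (a i))

lemma continuous_sparseDigitsPoint (D : ℕ) : Continuous (sparseDigitsPoint D) := by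
  unfold sparseDigitsPoint
  refine continuous_const.mul (Real.continuous_ofDigits.comp ?_)
  exact continuous_pi fun i =>
    (continuous_of_discreteTopology (f := Fin.castLE (by omega : D ≤ 4 * D))).comp
      (continuous_apply i)

lemma ofDigits_eq_head_add {b : ℕ} (a : ℕ → Fin b) :
    Real.ofDigits a = (b : ℝ)⁻¹ * (a 0 + Real.ofDigits fun i => a (i + 1)) := by
  rw [Real.ofDigits_eq_sum_add_ofDigits a 1]
  simp [Real.ofDigitsTerm]
  ring

lemma ofDigits_castLE_le {D : ℕ} (a : ℕ → Fin D) :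
    Real.ofDigits (fun i => Fin.castLE (by omega : D ≤ 4 * D) (a i)) ≤ 1 / 4 := by
  have hD : 0 < (D : ℝ) := by exact_mod_cast Fin.pos (a 0)
  have ha : ((a 0 : ℕ) : ℝ) + 1 ≤ D := by exact_mod_cast (a 0).isLt
  rw [ofDigits_eq_head_add]
  have := Real.ofDigits_le_one (fun i => Fin.castLE (by omega : D ≤ 4 * D) (a (i + 1)))
  rw [inv_mul_le_iff₀ (by push_cast; positivity)]
  push_cast
  simp only [Fin.val_castLE]
  linarith

/-- The leading digit 0 gives this bound, which makes the Cantor sets shrink to 0 as `D` grows. -/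
lemma sparseDigitsPoint_mem_Icc {D : ℕ} (a : ℕ → Fin D) :
    sparseDigitsPoint D a ∈ Icc 0 ((4 * D : ℕ) : ℝ)⁻¹ :=
  ⟨mul_nonneg (by positivity) (Real.ofDigits_nonneg _),
    mul_le_of_le_one_right (by positivity) (Real.ofDigits_le_one _)⟩

lemma exists_nat_pow_mul_ofDigits {b : ℕ} (a : ℕ → Fin b) (n : ℕ) :
    ∃ m : ℕ, (b : ℝ) ^ n * Real.ofDigits a = m + Real.ofDigits fun i => a (i + n) := by
  have hb : (b : ℝ) ≠ 0 := by exact_mod_cast (Fin.pos (a 0)).ne'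
  induction n with
  | zero => exact ⟨0, by simp⟩
  | succ n ih =>
    obtain ⟨m, hm⟩ := ih
    refine ⟨b * m + a n, ?_⟩
    rw [pow_succ', mul_assoc, hm, ofDigits_eq_head_add fun i => a (i + n)]
    push_cast
    simp only [zero_add, add_right_comm _ 1 n, ← add_assoc]
    field_simp
    ring

lemma sparseDigitsPoint_mem_shiftFractLE {l : ℕ} (a : ℕ → Fin (2 ^ l)) :
    sparseDigitsPoint (2 ^ l) a ∈ shiftFractLE (l + 2) (1 / 4) := by
  intro n
  have hb : ((4 * 2 ^ l : ℕ) : ℝ) = 2 ^ (l + 2) := by push_cast; ring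
  rw [pow_mul, ← hb]
  cases n with
  | zero =>
    have h := sparseDigitsPoint_mem_Icc a
    have h1 : ((4 * 2 ^ l : ℕ) : ℝ)⁻¹ ≤ 1 / 4 := by
      rw [one_div]
      refine inv_anti₀ (by norm_num) ?_
      exact_mod_cast Nat.le_mul_of_pos_right 4 (by positivity)
    rw [pow_zero, one_mul, Int.fract_eq_self.2 ⟨h.1, by linarith [h.2]⟩]
    exact h.2.trans h1
  | succ n =>
    obtain ⟨m, hm⟩ := exists_nat_pow_mul_ofDigits
      (fun i => Fin.castLE (by omega : 2 ^ l ≤ 4 * 2 ^ l) (a i)) n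
    have h : ((4 * 2 ^ l : ℕ) : ℝ) ^ (n + 1) * sparseDigitsPoint (2 ^ l) a =
        m + Real.ofDigits
          (fun i => Fin.castLE (by omega : 2 ^ l ≤ 4 * 2 ^ l) (a (i + n))) := by
      rw [← hm, sparseDigitsPoint, pow_succ]
      field_simp
    have hle := ofDigits_castLE_le fun i => a (i + n)
    rw [h, Int.fract_natCast_add, Int.fract_eq_self.2 ⟨Real.ofDigits_nonneg _, by linarith⟩]
    exact hle

/-- At the first disagreement the digits differ by at least 1, while both tails lie in `[0, 1/4]`.
The square accounts for the leading 0 and for the digit `n` itself. -/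
lemma le_abs_sparseDigitsPoint_sub {D n : ℕ} {x y : ℕ → Fin D} (hxy : ∀ i < n, x i = y i)
    (hn : x n ≠ y n) :
    3 / 4 * (((4 * D : ℕ) : ℝ) ^ 2)⁻¹ * (((4 * D : ℕ) : ℝ) ^ n)⁻¹ ≤
      |sparseDigitsPoint D x - sparseDigitsPoint D y| := by
  have hD : 0 < D := Fin.pos (x 0)
  set b : ℝ := ((4 * D : ℕ) : ℝ) with hb
  have hbpos : 0 < b := by rw [hb]; exact_mod_cast (by omega : 0 < 4 * D)
  set u : ℕ → Fin (4 * D) := fun i => Fin.castLE (by omega) (x i) with hu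
  set v : ℕ → Fin (4 * D) := fun i => Fin.castLE (by omega) (y i) with hv
  have hsum : ∑ i ∈ Finset.range n, Real.ofDigitsTerm u i =
      ∑ i ∈ Finset.range n, Real.ofDigitsTerm v i :=
    Finset.sum_congr rfl fun i hi => by
      simp [Real.ofDigitsTerm, hu, hv, hxy i (Finset.mem_range.1 hi)]
  set s := Real.ofDigits fun i => u (i + 1 + n) with hs
  set t := Real.ofDigits fun i => v (i + 1 + n) with ht
  have hs0 : 0 ≤ s := Real.ofDigits_nonneg _
  have ht0 : 0 ≤ t := Real.ofDigits_nonneg _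
  have hs1 : s ≤ 1 / 4 := ofDigits_castLE_le fun i => x (i + 1 + n)
  have ht1 : t ≤ 1 / 4 := ofDigits_castLE_le fun i => y (i + 1 + n)
  have hdiff : sparseDigitsPoint D x - sparseDigitsPoint D y =
      (b ^ 2)⁻¹ * (b ^ n)⁻¹ * ((x n : ℝ) + s - (y n + t)) := by
    change b⁻¹ * Real.ofDigits u - b⁻¹ * Real.ofDigits v = _
    rw [Real.ofDigits_eq_sum_add_ofDigits u n, Real.ofDigits_eq_sum_add_ofDigits v n, hsum,
      ofDigits_eq_head_add fun i => u (i + n), ofDigits_eq_head_add fun i => v (i + n)]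
    simp only [zero_add, ← hs, ← ht, ← hb]
    have h1 : ((u n : ℕ) : ℝ) = (x n : ℕ) := rfl
    have h2 : ((v n : ℕ) : ℝ) = (y n : ℕ) := rfl
    rw [h1, h2]
    field_simp
    ring
  have habs : (3 / 4 : ℝ) ≤ |(x n : ℝ) + s - (y n + t)| := by
    rcases lt_or_gt_of_ne (Fin.val_ne_of_ne hn) with h | h
    · have h' : ((x n : ℕ) : ℝ) + 1 ≤ (y n : ℕ) := by exact_mod_cast h
      rw [abs_sub_comm]
      exact le_trans (by linarith) (le_abs_self _)
    · have h' : ((y n : ℕ) : ℝ) + 1 ≤ (x n : ℕ) := by exact_mod_cast h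
      exact le_trans (by linarith) (le_abs_self _)
  rw [hdiff, abs_mul, abs_of_nonneg (by positivity), mul_assoc, mul_comm]
  gcongr

/-! ### Lower bound for the dimension -/

/-- A set parametrized by sequences of `D` digits so that sequences first differing at place `n`
are `c / b ^ n`-separated, where `b ^ r = D`, has Hausdorff dimension at least `r`. -/
lemma le_dimH_range_of_separated {D : ℕ} (hD : 1 < D) {r : NNReal} (hr : 0 < r) {c : ℝ}
    (hc : 0 < c) {b : ℝ} (hb : 0 < b) (hbD : b ^ (r : ℝ) = D) {g : (ℕ → Fin D) → ℝ}
    (hg : ∀ (x y : ℕ → Fin D) (n : ℕ), (∀ i < n, x i = y i) → x n ≠ y n →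
      c * (b ^ n)⁻¹ ≤ |g x - g y|) :
    (r : ENNReal) ≤ dimH (range g) := by
  classical
  have hfirst {x y : ℕ → Fin D} (hxy : x ≠ y) : ∃ n, (∀ i < n, x i = y i) ∧ x n ≠ y n := by
    have h : ∃ n, x n ≠ y n := Function.ne_iff.1 hxy
    exact ⟨Nat.find h, fun i hi => not_not.1 (Nat.find_min h hi), Nat.find_spec h⟩
  have hinj : Function.Injective g := by
    intro x y hxy
    by_contra hne
    obtain ⟨n, h1, h2⟩ := hfirst hne
    have := hg x y n h1 h2
    rw [hxy, sub_self, abs_zero] at this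
    have : 0 < c * (b ^ n)⁻¹ := by positivity
    linarith
  have : Nonempty (ℕ → Fin D) := ⟨fun _ => ⟨0, by omega⟩⟩
  -- Rereading the digits in base `D` maps the set onto `[0, 1]`; it is `r`-Hölder because `(b ^
  -- (-n)) ^ r = D ^ (-n)`.
  set f : ℝ → ℝ := fun t => Real.ofDigits (Function.invFun g t) with hf
  have hfg (x : ℕ → Fin D) : f (g x) = Real.ofDigits x := by
    rw [hf]
    simp only [Function.leftInverse_invFun hinj x]
  have hholder : HolderOnWith (c⁻¹ ^ (r : ℝ)).toNNReal r f (range g) := by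
    rintro _ ⟨x, rfl⟩ _ ⟨y, rfl⟩
    rw [hfg, hfg]
    by_cases hxy : x = y
    · simp [hxy]
    obtain ⟨n, h1, h2⟩ := hfirst hxy
    have hle : |Real.ofDigits x - Real.ofDigits y| ≤ c⁻¹ ^ (r : ℝ) * |g x - g y| ^ (r : ℝ) := by
      calc |Real.ofDigits x - Real.ofDigits y| ≤ ((D : ℝ) ^ n)⁻¹ :=
            Real.abs_ofDigits_sub_ofDigits_le h1
        _ = ((b ^ n)⁻¹) ^ (r : ℝ) := by
            rw [← hbD, Real.inv_rpow (by positivity), ← Real.rpow_natCast, ← Real.rpow_natCast,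
              ← Real.rpow_mul hb.le, ← Real.rpow_mul hb.le, mul_comm]
        _ ≤ (c⁻¹ * |g x - g y|) ^ (r : ℝ) := by
            refine Real.rpow_le_rpow (by positivity) ?_ r.coe_nonneg
            rw [le_inv_mul_iff₀ hc]
            exact hg x y n h1 h2
        _ = _ := Real.mul_rpow (by positivity) (abs_nonneg _)
    rw [edist_dist, edist_dist, Real.dist_eq, Real.dist_eq,
      ENNReal.ofReal_rpow_of_nonneg (abs_nonneg _) r.coe_nonneg]
    change _ ≤ ENNReal.ofReal _ * _
    rw [← ENNReal.ofReal_mul (by positivity)]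
    exact ENNReal.ofReal_le_ofReal hle
  have hsurj : Icc (0 : ℝ) 1 ⊆ f '' range g := by
    intro t ht
    obtain ⟨x, -, rfl⟩ := Real.ofDigits_SurjOn hD ht
    exact ⟨g x, mem_range_self x, hfg x⟩
  have hone : dimH (Icc (0 : ℝ) 1) = 1 := by
    rw [Real.dimH_of_nonempty_interior (by simp)]
    simp
  have h := (hone ▸ dimH_mono hsurj).trans (hholder.dimH_image_le hr)
  rw [ENNReal.le_div_iff_mul_le (by simp [hr.ne']) (by simp)] at h
  simpa using h

lemma le_dimH_range_sparseDigitsPoint {l : ℕ} (hl : 0 < l) :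
    ((l / (l + 2) : NNReal) : ENNReal) ≤ dimH (range (sparseDigitsPoint (2 ^ l))) := by
  have hb : ((4 * 2 ^ l : ℕ) : ℝ) = 2 ^ (l + 2) := by push_cast; ring
  have hpos : 0 < ((4 * 2 ^ l : ℕ) : ℝ) := by rw [hb]; positivity
  refine le_dimH_range_of_separated (c := 3 / 4 * (((4 * 2 ^ l : ℕ) : ℝ) ^ 2)⁻¹)
    (b := ((4 * 2 ^ l : ℕ) : ℝ)) (Nat.one_lt_two_pow hl.ne') (by positivity)
    (by positivity) hpos ?_ fun x y n => le_abs_sparseDigitsPoint_sub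
  rw [hb, ← Real.rpow_natCast, ← Real.rpow_mul (by norm_num)]
  push_cast
  rw [mul_div_cancel₀ _ (by positivity), Real.rpow_natCast]

/-! ### Assembling the null sumset -/

lemma isCompact_insert_iUnion_of_subset_closedBall {X : Type*} [PseudoMetricSpace X] {a : X}
    {K : ℕ → Set X} (hK : ∀ n, IsCompact (K n)) {r : ℕ → ℝ} (hr : Tendsto r atTop (𝓝 0))
    (hsub : ∀ n, K n ⊆ Metric.closedBall a (r n)) : IsCompact (insert a (⋃ n, K n)) := by
  rw [isCompact_iff_ultrafilter_le_nhds]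
  intro f hf
  by_cases ha : (f : Filter X) ≤ 𝓝 a
  · exact ⟨a, mem_insert _ _, ha⟩
  obtain ⟨ε, hε, hεf⟩ : ∃ ε > 0, Metric.ball a ε ∉ f := by
    by_contra! h
    exact ha (Metric.nhds_basis_ball.ge_iff.2 h)
  obtain ⟨N, hN⟩ := eventually_atTop.1 (hr.eventually (gt_mem_nhds hε))
  have hfin : IsCompact (⋃ n ∈ Finset.range N, K n) :=
    (Finset.range N).isCompact_biUnion fun n _ => hK n
  have hmem : (⋃ n ∈ Finset.range N, K n) ∈ f := by
    filter_upwards [le_principal_iff.1 hf, Ultrafilter.compl_mem_iff_notMem.2 hεf] with x hx hxε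
    rcases hx with rfl | hx
    · exact absurd (Metric.mem_ball_self hε) hxε
    obtain ⟨n, hn⟩ := mem_iUnion.1 hx
    refine mem_biUnion (Finset.mem_coe.2 (Finset.mem_range.2 ?_)) hn
    by_contra! hNn
    exact hxε (Metric.mem_ball.2 ((Metric.mem_closedBall.1 (hsub n hn)).trans_lt (hN n hNn)))
  obtain ⟨x, hx, hfx⟩ := isCompact_iff_ultrafilter_le_nhds.1 hfin f (le_principal_iff.2 hmem)
  obtain ⟨n, -, hn⟩ := mem_iUnion₂.1 hx
  exact ⟨x, mem_insert_of_mem _ (mem_iUnion.2 ⟨n, hn⟩), hfx⟩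

/-- There is a compact set of nonnegative reals with full Hausdorff dimension
and null sumset. -/
lemma exists_isCompact_dimH_eq_one_volume_add_eq_zero :
    ∃ G : Set ℝ, IsCompact G ∧ (∀ x ∈ G, 0 ≤ x) ∧ dimH G = 1 ∧
      volume {t : ℝ | ∃ x ∈ G, ∃ y ∈ G, t = x + y} = 0 := by
  -- This makes `l j + 2` a power of 2, so the exponents of the bases divide one another.
  set l : ℕ → ℕ := fun j => 2 ^ (j + 2) - 2 with hl
  have hl2 (j : ℕ) : l j + 2 = 2 ^ (j + 2) :=
    Nat.sub_add_cancel (Nat.le_self_pow (by omega) 2)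
  have hlj (j : ℕ) : j < l j := by
    have h1 := hl2 j
    have h2 : j + 2 < 2 ^ (j + 2) := Nat.lt_two_pow_self
    omega
  set K : ℕ → Set ℝ := fun j => range (sparseDigitsPoint (2 ^ l j)) with hK
  have hKcompact (j : ℕ) : IsCompact (K j) :=
    isCompact_range (continuous_sparseDigitsPoint _)
  have hKnonneg (j : ℕ) : ∀ x ∈ K j, 0 ≤ x := by
    rintro _ ⟨a, rfl⟩
    exact (sparseDigitsPoint_mem_Icc a).1
  have hKsub (j : ℕ) : K j ⊆ Metric.closedBall 0 ((1 / 2) ^ j) := by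
    rintro _ ⟨a, rfl⟩
    have h := sparseDigitsPoint_mem_Icc a
    rw [mem_closedBall_zero_iff, Real.norm_of_nonneg h.1]
    refine h.2.trans ?_
    rw [one_div, inv_pow]
    refine inv_anti₀ (by positivity) ?_
    have : 2 ^ j ≤ 2 ^ l j := Nat.pow_le_pow_right (by norm_num) (hlj j).le
    exact_mod_cast (by omega : 2 ^ j ≤ 4 * 2 ^ l j)
  have hKshift (i j : ℕ) (hij : i ≤ j) : insert 0 (K i) ⊆ shiftFractLE (2 ^ (j + 2)) (1 / 4) := by
    rintro _ (rfl | ⟨a, rfl⟩)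
    · intro n
      norm_num
    · refine shiftFractLE_subset_of_dvd (pow_dvd_pow 2 (by omega : i + 2 ≤ j + 2)) _ ?_
      rw [← hl2 i]
      exact sparseDigitsPoint_mem_shiftFractLE a
  refine ⟨insert 0 (⋃ j, K j), ?_, ?_, le_antisymm ?_ ?_, ?_⟩
  · exact isCompact_insert_iUnion_of_subset_closedBall hKcompact
      (tendsto_pow_atTop_nhds_zero_of_lt_one (by norm_num) (by norm_num)) hKsub
  · rintro x (rfl | hx)
    · exact le_rfl
    · obtain ⟨j, hj⟩ := mem_iUnion.1 hx
      exact hKnonneg j x hj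
  · exact (dimH_mono (subset_univ _)).trans_eq Real.dimH_univ
  · have hlim : Tendsto (fun j : ℕ => (((l j : NNReal) / (l j + 2) : NNReal) : ENNReal)) atTop
        (𝓝 1) := by
      rw [← ENNReal.coe_one, ENNReal.tendsto_coe, ← NNReal.tendsto_coe]
      have hltop : Tendsto l atTop atTop :=
        tendsto_atTop_mono (fun j => (hlj j).le) tendsto_id
      push_cast
      exact (tendsto_natCast_div_add_atTop (2 : ℝ)).comp hltop
    refine le_of_tendsto' hlim fun j => ?_
    refine (le_dimH_range_sparseDigitsPoint (Nat.zero_lt_of_lt (hlj j))).trans (dimH_mono ?_)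
    exact (subset_iUnion K j).trans (subset_insert _ _)
  · refine measure_mono_null (t := ⋃ j : ℕ, shiftFractLE (2 ^ (j + 2)) (1 / 2)) ?_
      (measure_iUnion_null fun j => volume_shiftFractLE_half (Nat.le_self_pow (by omega) 2))
    have hex {x : ℝ} (hx : x ∈ insert 0 (⋃ j, K j)) : ∃ j, x ∈ insert 0 (K j) := by
      rcases hx with rfl | hx
      · exact ⟨0, mem_insert _ _⟩
      · obtain ⟨j, hj⟩ := mem_iUnion.1 hx
        exact ⟨j, mem_insert_of_mem _ hj⟩
    rintro _ ⟨x, hx, y, hy, rfl⟩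
    obtain ⟨i, hi⟩ := hex hx
    obtain ⟨j, hj⟩ := hex hy
    refine mem_iUnion.2 ⟨max i j, ?_⟩
    have := add_mem_shiftFractLE (hKshift i _ (le_max_left i j) hi)
      (hKshift j _ (le_max_right i j) hj)
    norm_num at this ⊢
    exact this

/-! ### Transfer to products and to the parabola -/

lemma dimH_le_dimH_exp_image {G : Set ℝ} (hG : ∀ x ∈ G, 0 ≤ x) :
    dimH G ≤ dimH (Real.exp '' G) := by
  -- Nonnegativity of `G` puts its image in `[1, ∞)`, where the inverse `log` is 1-Lipschitz.
  have hlog : LipschitzOnWith 1 Real.log (Ici 1) := by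
    refine (convex_Ici 1).lipschitzOnWith_of_nnnorm_deriv_le (𝕜 := ℝ) ?_ ?_
    · intro x hx
      exact Real.differentiableAt_log (zero_lt_one.trans_le hx).ne'
    · intro x hx
      rw [Real.deriv_log, ← NNReal.coe_le_coe, coe_nnnorm, Real.norm_of_nonneg
        (inv_nonneg.2 (zero_le_one.trans hx))]
      exact inv_le_one_of_one_le₀ hx
  have hsub : Real.exp '' G ⊆ Ici 1 := by
    rintro _ ⟨x, hx, rfl⟩
    exact Real.one_le_exp (hG x hx)
  simpa [image_image] using (hlog.mono hsub).dimH_image_le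

/-- There is a compact set of reals with full Hausdorff dimension and null product set. -/
lemma exists_isCompact_dimH_eq_one_volume_mul_eq_zero :
    ∃ F : Set ℝ, IsCompact F ∧ dimH F = 1 ∧
      volume {t : ℝ | ∃ x ∈ F, ∃ y ∈ F, t = x * y} = 0 := by
  obtain ⟨G, hGc, hG0, hGdim, hGnull⟩ := exists_isCompact_dimH_eq_one_volume_add_eq_zero
  refine ⟨Real.exp '' G, hGc.image Real.continuous_exp, le_antisymm ?_ ?_, ?_⟩
  · exact (dimH_mono (subset_univ _)).trans_eq Real.dimH_univ
  · exact hGdim ▸ dimH_le_dimH_exp_image hG0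
  · refine measure_mono_null ?_ (addHaar_image_eq_zero_of_differentiableOn_of_addHaar_eq_zero volume
      (Real.differentiable_exp.differentiableOn) hGnull)
    rintro _ ⟨_, ⟨x, hx, rfl⟩, _, ⟨y, hy, rfl⟩, rfl⟩
    exact ⟨x + y, ⟨x, hx, y, hy, rfl⟩, Real.exp_add x y⟩

lemma inner_parabolaPoint (x y : ℝ) :
    inner ℝ (parabolaPoint x) (parabolaPoint y) = (x * y + 1 / 2) ^ 2 - 1 / 4 := by
  simp [parabolaPoint, PiLp.inner_apply, Fin.sum_univ_two]
  ring

lemma contDiff_parabolaPoint : ContDiff ℝ 1 parabolaPoint := by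
  rw [contDiff_euclidean]
  intro i
  fin_cases i
  · exact contDiff_id
  · exact contDiff_id.pow 2

lemma dimH_parabolaPoint_image_le (F : Set ℝ) : dimH (parabolaPoint '' F) ≤ 1 :=
  (dimH_mono (image_subset_range _ _)).trans (by
    simpa using contDiff_parabolaPoint.dimH_range_le)

lemma dimH_le_dimH_parabolaPoint_image (F : Set ℝ) : dimH F ≤ dimH (parabolaPoint '' F) := by
  have h : AntilipschitzWith 1 parabolaPoint := by
    refine AntilipschitzWith.of_le_mul_dist fun x y => ?_
    rw [NNReal.coe_one, one_mul, dist_eq_norm, dist_eq_norm]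
    simpa [parabolaPoint] using PiLp.norm_apply_le (parabolaPoint x - parabolaPoint y) 0
  exact h.le_dimH_image F

lemma volume_dotProductSet_parabolaPoint_image {F : Set ℝ}
    (hF : volume {t : ℝ | ∃ x ∈ F, ∃ y ∈ F, t = x * y} = 0) :
    volume (dotProductSet (parabolaPoint '' F)) = 0 := by
  have hd : Differentiable ℝ fun t : ℝ => (t + 1 / 2) ^ 2 - 1 / 4 := by fun_prop
  refine measure_mono_null ?_ (addHaar_image_eq_zero_of_differentiableOn_of_addHaar_eq_zero volume
    hd.differentiableOn hF)
  rintro _ ⟨_, ⟨x, hx, rfl⟩, _, ⟨y, hy, rfl⟩, rfl⟩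
  exact ⟨x * y, ⟨x, hx, y, hy, rfl⟩, (inner_parabolaPoint x y).symm⟩

theorem mainTheorem7 :
    (∀ x y : ℝ,
      inner ℝ (parabolaPoint x) (parabolaPoint y) = (x * y + 1 / 2) ^ 2 - 1 / 4) ∧
    ∃ (F : Set ℝ) (E : Set (EuclideanSpace ℝ (Fin 2))),
      (IsCompact F ∧ dimH F = 1 ∧
        volume {t : ℝ | ∃ x ∈ F, ∃ y ∈ F, t = x * y} = 0) ∧
      E = parabolaPoint '' F ∧
      (IsCompact E ∧ E ⊆ standardParabola ∧ dimH E = 1 ∧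
        volume (dotProductSet E) = 0) := by
  obtain ⟨F, hFc, hFdim, hFnull⟩ := exists_isCompact_dimH_eq_one_volume_mul_eq_zero
  exact ⟨inner_parabolaPoint, F, parabolaPoint '' F, ⟨hFc, hFdim, hFnull⟩, rfl,
    hFc.image contDiff_parabolaPoint.continuous, image_subset_range _ _,
    le_antisymm (dimH_parabolaPoint_image_le F)
      (hFdim ▸ dimH_le_dimH_parabolaPoint_image F),
    volume_dotProductSet_parabolaPoint_image hFnull⟩
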